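/- For every constant $K$ there is a constant $c>0$, depending only on $K$, such that the following holds for every $n\ge 1$. Let $\mathbb F$ be a field and let $f\in\mathbb F[q_1,\dots,q_n]$ be a symmetric polynomial of total degree $d\le K\log n$ that is not constant on $\{0,1\}^n$. Assume that $\operatorname{char}\mathbb F$ is $0$ or larger than $\max\bigl(2^{4n+2\binom n2},\,n^d\bigr)$. Let $h\in\mathbb F[y_1,\dots,y_n]$ be the polynomial with $f=h(e_{1,n}(q),\dots,e_{n,n}(q))$, where $e_{k,N}$ denotes the $k$-th elementary symmetric polynomial in $N$ variables. Let $m=\binom{2n}{2}$, let $w=(w_{i,j})_{1\le i<j\le 2n}$, and define, in the variables $x_1,\dots,x_{2n}$ and $z_{i,j}$ ($1\le i<j\le 2n$), $$f^\star(z,x)=h\bigl(e_{1,m}(w),\dots,e_{n,m}(w)\bigr)\Big|_{w_{i,j}\mapsto z_{i,j}x_ix_j}.$$ Let $\beta\in\mathbb F$ be such that neither $f(q)-\beta=0$ nor $f^\star(z,x)-\beta=0$ has a solution with all variables in $\{0,1\}$. Then every roABP-$\mathrm{IPS}_{\mathrm{LIN}'}$ refutation of $f^\star(z,x)-\beta=0$,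 in any variable order, has size at least $2^{cn}$. Here, writing $v$ for the list of all the variables $x_i$ and $z_{i,j}$, an $\mathrm{IPS}_{\mathrm{LIN}'}$ refutation of $f^\star-\beta=0$ is a polynomial $C(v,y,u)$, with one new variable $y$ and one new variable $u_k$ for each variable $v_k$, such that $C(v,0,0)=0$ and $C\bigl(v,\,f^\star-\beta,\,(v_k^2-v_k)_k\bigr)=1$ as formal polynomials and $C$ has degree at most $1$ in $y$. It is a roABP-$\mathrm{IPS}_{\mathrm{LIN}'}$ refutation if $C$ is given by a read-once oblivious algebraic branching program (roABP). A roABP in $N$ variables consists of an order of the variables and a layered directed graph with vertex layers $V_0,\dots,V_N$, $|V_0|=|V_N|=1$, and edges from $V_{i-1}$ to $V_i$ labelled by univariate polynomials in the $i$-th variable of the order. It computes the sum, over all paths from $V_0$ to $V_N$, of the product of the edge labels. Its size is $N\cdot r\cdot \delta\cdot N$, where $r=\max_i|V_i|$ and $\delta$ is the maximal degree of an edge label. -/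

import Mathlib

/-- `P = 0` has no solution with all variables in `{0, 1}`. -/
def BooleanUnsat {F σ : Type*} [Field F] (P : MvPolynomial σ F) : Prop :=
  ∀ a : σ → F, (∀ i, a i = 0 ∨ a i = 1) → MvPolynomial.eval a P ≠ 0

/-- `P` takes two different values on the Boolean cube. -/
def NonconstantOnCube {F σ : Type*} [Field F] (P : MvPolynomial σ F) : Prop :=
  ∃ a b : σ → F, (∀ i, a i = 0 ∨ a i = 1) ∧ (∀ i, b i = 0 ∨ b i = 1) ∧
    MvPolynomial.eval a P ≠ MvPolynomial.eval b P

/-- A read-once oblivious algebraic branching program over the finite set `τ` of variables.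
There are `card τ` layers of edges, and `order` says which variable is read in which layer.
The vertices of layer `i` are `Fin (layer i)`; the first and the last layer
are the source and the sink. Every edge of a layer is labelled by a univariate polynomial in the
variable of that layer; a missing edge is an edge with label `0`. -/
structure RoABP (F τ : Type*) [Field F] [Fintype τ] where
  order : Fin (Fintype.card τ) ≃ τ
  layer : Fin (Fintype.card τ + 1) → ℕ
  layer_source : layer 0 = 1
  layer_sink : layer (Fin.last _) = 1
  label : (i : Fin (Fintype.card τ)) → Fin (layer i.castSucc) → Fin (layer i.succ) → Polynomial F

namespace RoABP

variable {F τ : Type*} [Field F] [Fintype τ]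

/-- The computed polynomial: the sum over all source-sink paths `q` of the product of the
labels on the edges of `q`. -/
noncomputable def poly (P : RoABP F τ) : MvPolynomial τ F :=
  ∑ q : ((i : Fin (Fintype.card τ + 1)) → Fin (P.layer i)),
    ∏ i : Fin (Fintype.card τ),
      Polynomial.aeval (MvPolynomial.X (P.order i) : MvPolynomial τ F)
        (P.label i (q i.castSucc) (q i.succ))

/-- The maximal number of vertices in a layer. -/
def width (P : RoABP F τ) : ℕ := Finset.univ.sup P.layer

/-- The maximal degree of an edge label. -/
noncomputable def degree (P : RoABP F τ) : ℕ :=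
  Finset.univ.sup fun i : Fin (Fintype.card τ) =>
    Finset.univ.sup fun e : Fin (P.layer i.castSucc) × Fin (P.layer i.succ) =>
      (P.label i e.1 e.2).natDegree

/-- Number of variables times width times degree times depth; the depth of a read-once program
is its number of variables. -/
noncomputable def size (P : RoABP F τ) : ℕ :=
  Fintype.card τ * P.width * P.degree * Fintype.card τ

end RoABP

/-- The variables of an IPS proof: the variables `σ` of the axioms, one placeholder for each
axiom in `ι`, and one placeholder for the Boolean axiom of each variable in `σ`. -/
abbrev IPSVar (σ ι : Type*) : Type _ := σ ⊕ (ι ⊕ σ)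

/-- `C(x, y, z)` is an `IPS_LIN'` refutation of the axioms `f j = 0` and the Boolean axioms:
`C(x, 0, 0) = 0`, `C(x, f, x² - x) = 1`, and `C` has individual degree at most one in each
placeholder `y j`. -/
def IsIPSLinPrimeRefutation {F σ ι : Type*} [Field F] (f : ι → MvPolynomial σ F)
    (C : MvPolynomial (IPSVar σ ι) F) : Prop :=
  MvPolynomial.aeval (Sum.elim MvPolynomial.X fun _ => (0 : MvPolynomial σ F)) C = 0 ∧
  MvPolynomial.aeval (Sum.elim MvPolynomial.X
    (Sum.elim f fun i => (MvPolynomial.X i ^ 2 - MvPolynomial.X i : MvPolynomial σ F))) C = 1 ∧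
  ∀ j : ι, C.degreeOf (Sum.inr (Sum.inl j)) ≤ 1

/-- The pairs `i < j` in `[2n]`. -/
abbrev Pairs (n : ℕ) : Type := {p : Fin (2 * n) × Fin (2 * n) // p.1 < p.2}

/-- The variables of the lifted instance: `x i` for `i ∈ [2n]`, and `z i j` for `i < j`. -/
abbrev LiftVar (n : ℕ) : Type := Fin (2 * n) ⊕ Pairs n

/-- The gadget `w i j ↦ z i j * x i * x j`. -/
noncomputable def gadget (F : Type*) [Field F] (n : ℕ) (p : Pairs n) :
    MvPolynomial (LiftVar n) F :=
  MvPolynomial.X (Sum.inr p) * MvPolynomial.X (Sum.inl p.1.1) * MvPolynomial.X (Sum.inl p.1.2)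

/-- `h(e_1, …, e_n)` with the elementary symmetric polynomials in `n` variables. -/
noncomputable def substEsymm {F : Type*} [Field F] {n : ℕ} (h : MvPolynomial (Fin n) F) :
    MvPolynomial (Fin n) F :=
  MvPolynomial.aeval (fun k : Fin n => MvPolynomial.esymm (Fin n) F (k + 1)) h

/-- `h(e_1, …, e_n)` with the elementary symmetric polynomials in the `binom(2n, 2)` variables
`w i j`, in which the gadget is then substituted. This is `f⋆` for the symmetric polynomial
`f = substEsymm h`; by the fundamental theorem `h` exists and is determined by `f`. -/
noncomputable def liftSymm {F : Type*} [Field F] {n : ℕ} (h : MvPolynomial (Fin n) F) :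
    MvPolynomial (LiftVar n) F :=
  MvPolynomial.aeval
    (fun k : Fin n =>
      MvPolynomial.aeval (gadget F n) (MvPolynomial.esymm (Pairs n) F (k + 1))) h

/-! At a Boolean point the Boolean axioms vanish. Since `C` is affine in `y` and zero at `y = u =
0`, fixing `y = 1`, `u = 0` gives a function inverse to `f⋆ - β` on the cube
(`IsIPSLinPrimeRefutation.eval_mul_eval_eq_one`). It therefore suffices to bound the width needed to
compute this inverse.

For a given order, split the `x` variables into the `n` read first and the `n` read last, and let
`z` be the indicator of a perfect matching between the halves. With 0/1 vectors of supports `S`, `T`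
on the halves, `f⋆ - β` becomes `G |S ∩ T|`, where `G k` is the value of `f - β` at weight `k`.
Cutting the program between the halves shows that the matrix `φ |S ∩ T|`, with `φ = 1 / G`, has rank
at most the width.

Newton's formula factors this matrix as `Z D Zᵀ`, with `Z` the invertible inclusion matrix and `D`
the diagonal of differences `Δ^|U| φ(0)`. One nonzero `Δ^t φ(0)` thus forces rank at least `binom n
t`. Some `t` in `[n/4, n/2]` works: otherwise `φ` agrees on `0, …, n/2` with a polynomial of degree
below `n/4`, whose product with the interpolant of `G`, of degree at most `d`, must be identically
`1`. Then `G` would be constant. -/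

/-- The 0/1 vector with support `S`. -/
def boolVec (F : Type*) [Field F] {ι : Type*} [DecidableEq ι] (S : Finset ι) (i : ι) : F :=
  if i ∈ S then 1 else 0

/-- The value of `h(e_1, …, e_n)` at a 0/1 vector of weight `s`. -/
noncomputable def weightValue {F : Type*} [Field F] {n : ℕ} (h : MvPolynomial (Fin n) F)
    (s : ℕ) : F :=
  MvPolynomial.eval (fun k : Fin n => ((s.choose (k + 1) : ℕ) : F)) h

/-! ### Values of symmetric polynomials on the cube -/

section Evaluation

variable {F : Type*} [Field F]

theorem eval_esymm_boolVec {ι : Type*} [Fintype ι] [DecidableEq ι] (S : Finset ι) (k : ℕ) :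
    MvPolynomial.eval (boolVec F S) (MvPolynomial.esymm ι F k) = ((S.card.choose k : ℕ) : F) := by
  simp only [MvPolynomial.esymm, map_sum, map_prod, MvPolynomial.eval_X, boolVec,
    Finset.prod_ite_zero, Finset.prod_const_one]
  rw [← Finset.card_powersetCard, Finset.sum_boole]
  congr 2
  ext T
  simp only [Finset.mem_filter, Finset.mem_powersetCard, Finset.subset_univ, true_and]
  exact and_comm

theorem eval_aeval_eq_eval {σ τ : Type*} (a : τ → F) (g : σ → MvPolynomial τ F)
    (p : MvPolynomial σ F) :
    MvPolynomial.eval a (MvPolynomial.aeval g p) =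
      MvPolynomial.eval (fun i => MvPolynomial.eval a (g i)) p := by
  rw [MvPolynomial.map_aeval, MvPolynomial.coe_eval₂Hom, MvPolynomial.eval,
    MvPolynomial.coe_eval₂Hom]
  congr 1
  ext c
  simp

theorem eval_substEsymm_boolVec {n : ℕ} (h : MvPolynomial (Fin n) F) (S : Finset (Fin n)) :
    MvPolynomial.eval (boolVec F S) (substEsymm h) = weightValue h S.card := by
  simp only [substEsymm, weightValue, eval_aeval_eq_eval, eval_esymm_boolVec]

theorem eval_liftSymm {n : ℕ} (h : MvPolynomial (Fin n) F) (a : LiftVar n → F)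
    (S : Finset (Pairs n))
    (ha : ∀ p, MvPolynomial.eval a (gadget F n p) = boolVec F S p) :
    MvPolynomial.eval a (liftSymm h) = weightValue h S.card := by
  simp only [liftSymm, weightValue, eval_aeval_eq_eval, ha]
  congr 2
  funext k
  exact eval_esymm_boolVec S _

theorem exists_eq_boolVec {ι : Type*} [Fintype ι] [DecidableEq ι] (a : ι → F)
    (ha : ∀ i, a i = 0 ∨ a i = 1) : ∃ S : Finset ι, a = boolVec F S := by
  classical
  refine ⟨Finset.univ.filter fun i => a i = 1, funext fun i => ?_⟩
  rcases ha i with h | h <;> simp [boolVec, h]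

/-- An alternating sum over the subsets of a set larger than the total degree vanishes. -/
theorem sum_powerset_neg_one_pow_mul_eval {ι : Type*} [Fintype ι] [DecidableEq ι]
    (f : MvPolynomial ι F) (T : Finset ι) (hT : f.totalDegree < T.card) :
    ∑ S ∈ T.powerset, (-1 : F) ^ (T.card - S.card) * MvPolynomial.eval (boolVec F S) f = 0 := by
  simp only [MvPolynomial.eval_eq', Finset.mul_sum]
  rw [Finset.sum_comm]
  refine Finset.sum_eq_zero fun m hm => ?_
  -- A monomial of degree below `|T|` omits some `i ∈ T`, so the terms for `S` and `insert i S`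
  -- cancel.
  obtain ⟨i, hiT, him⟩ : ∃ i ∈ T, m i = 0 := by
    by_contra! hne
    have h1 : T ⊆ m.support := fun i hi => Finsupp.mem_support_iff.2 (hne i hi)
    have h2 : m.support.card ≤ m.sum fun _ e => e := by
      rw [Finsupp.sum, Finset.card_eq_sum_ones]
      exact Finset.sum_le_sum fun i hi => Nat.one_le_iff_ne_zero.2 (Finsupp.mem_support_iff.1 hi)
    have h3 := MvPolynomial.le_totalDegree hm
    have h4 := Finset.card_le_card h1
    omega
  rw [← Finset.insert_erase hiT, Finset.sum_powerset_insert (Finset.notMem_erase i T),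
    ← Finset.sum_add_distrib]
  refine Finset.sum_eq_zero fun S hS => ?_
  have hST := Finset.mem_powerset.1 hS
  have hiS : i ∉ S := fun hi => Finset.notMem_erase i T (hST hi)
  have hcard := Finset.card_le_card hST
  have hprod : ∏ j, boolVec F (insert i S) j ^ m j = ∏ j, boolVec F S j ^ m j := by
    refine Finset.prod_congr rfl fun j _ => ?_
    by_cases hj : j = i
    · subst hj; simp [him]
    · simp [boolVec, hj]
  rw [hprod, Finset.card_insert_of_notMem (Finset.notMem_erase i T),
    Finset.card_insert_of_notMem hiS,
    show (T.erase i).card + 1 - S.card = (T.erase i).card + 1 - (S.card + 1) + 1 by omega, pow_succ]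
  ring

/-- Grouping the subsets of a `t`-element set by size turns the vanishing alternating sum into the
`t`-th difference. Thus `weightValue h` behaves on `0, …, n` like a polynomial of degree at most
that of `f`. -/
theorem fwdDiff_iter_weightValue_eq_zero {n : ℕ} (h : MvPolynomial (Fin n) F) {t : ℕ}
    (ht : (substEsymm h).totalDegree < t) (htn : t ≤ n) :
    (fwdDiff 1)^[t] (weightValue h) 0 = 0 := by
  obtain ⟨T, -, rfl⟩ := Finset.exists_subset_card_eq (s := (Finset.univ : Finset (Fin n)))
    (by simpa using htn)
  rw [← sum_powerset_neg_one_pow_mul_eval (substEsymm h) T ht]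
  simp only [eval_substEsymm_boolVec]
  rw [Finset.sum_powerset_apply_card
    (fun s => (-1 : F) ^ (T.card - s) * weightValue h s), fwdDiff_iter_eq_sum_shift]
  refine Finset.sum_congr rfl fun k _ => ?_
  simp only [zsmul_eq_mul, nsmul_eq_mul, smul_eq_mul, mul_one, zero_add]
  push_cast
  ring

end Evaluation

/-! ### Newton interpolation and finite differences of the inverse -/

section Newton

variable {F : Type*} [Field F]

/-- The polynomial of degree less than `m` that interpolates `φ` at `0, …, m - 1`. -/
noncomputable def newtonPoly (φ : ℕ → F) (m : ℕ) : Polynomial F :=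
  ∑ j ∈ Finset.range m,
    Polynomial.C ((fwdDiff 1)^[j] φ 0 / (j.factorial : F)) * descPochhammer F j

theorem natDegree_newtonPoly_le (φ : ℕ → F) (m : ℕ) : (newtonPoly φ m).natDegree ≤ m - 1 := by
  refine Polynomial.natDegree_sum_le_of_forall_le _ _ fun j hj => ?_
  refine (Polynomial.natDegree_C_mul_le _ _).trans ?_
  rw [descPochhammer_natDegree]
  have := Finset.mem_range.1 hj
  omega

/-- In Newton's forward formula for `φ k`, the terms with `j ≥ m` vanish by `hφ` and those with `j >
k` by the binomial coefficient, so truncating at `m` is harmless. -/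
theorem eval_newtonPoly (φ : ℕ → F) {m b k : ℕ} (hm : ∀ j < m, (j.factorial : F) ≠ 0)
    (hφ : ∀ j, m ≤ j → j ≤ b → (fwdDiff 1)^[j] φ 0 = 0) (hk : k ≤ b) :
    (newtonPoly φ m).eval (k : F) = φ k := by
  have h1 := shift_eq_sum_fwdDiff_iter 1 φ k 0
  simp only [smul_eq_mul, mul_one, zero_add] at h1
  rw [h1, newtonPoly, Polynomial.eval_finsetSum]
  have h2 : ∀ j ∈ Finset.range m,
      (Polynomial.C ((fwdDiff 1)^[j] φ 0 / (j.factorial : F)) * descPochhammer F j).eval (k : F)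
        = k.choose j • (fwdDiff 1)^[j] φ 0 := by
    intro j hj
    have := hm j (Finset.mem_range.1 hj)
    rw [Polynomial.eval_mul, Polynomial.eval_C, descPochhammer_eval_eq_descFactorial,
      Nat.descFactorial_eq_factorial_mul_choose, nsmul_eq_mul]
    push_cast
    field_simp
  rw [Finset.sum_congr rfl h2]
  rcases le_total m (k + 1) with hmk | hmk
  · refine Finset.sum_subset (Finset.range_subset_range.2 hmk) fun j hj hj' => ?_
    rw [hφ j (by simpa using hj') (by have := Finset.mem_range.1 hj; omega), smul_zero]
  · refine (Finset.sum_subset (Finset.range_subset_range.2 hmk) fun j _ hj' => ?_).symm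
    rw [Nat.choose_eq_zero_of_lt (by have := Finset.mem_range.not.1 hj'; omega), zero_smul]

theorem factorial_cast_ne_zero {n : ℕ} (hF : ∀ k : ℕ, 0 < k → k ≤ n → (k : F) ≠ 0) {j : ℕ}
    (hj : j ≤ n) : (j.factorial : F) ≠ 0 := by
  induction j with
  | zero => simp
  | succ j ih =>
    rw [Nat.factorial_succ, Nat.cast_mul]
    exact mul_ne_zero (hF _ j.succ_pos hj) (ih (by omega))

theorem natCast_inj_of_le {n : ℕ} (hF : ∀ k : ℕ, 0 < k → k ≤ n → (k : F) ≠ 0) {j k : ℕ}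
    (hj : j ≤ n) (hk : k ≤ n) (h : (j : F) = k) : j = k := by
  wlog hjk : j ≤ k generalizing j k
  · exact (this hk hj h.symm (by omega)).symm
  by_contra hne
  apply hF (k - j) (by omega) (by omega)
  rw [Nat.cast_sub hjk, h, sub_self]

/-- If `G` is nonconstant of degree at most `d` on `0, …, n`, then the pointwise inverse `φ` of `G`
has a nonzero finite difference at `0` of some order in any long enough interval. -/
theorem exists_fwdDiff_iter_ne_zero {n a b d : ℕ}
    (hF : ∀ k : ℕ, 0 < k → k ≤ n → (k : F) ≠ 0) (hb : b ≤ n) (ha : 1 ≤ a) (hab : a + d ≤ b)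
    (G φ : ℕ → F) (hG : ∀ j, d < j → j ≤ n → (fwdDiff 1)^[j] G 0 = 0)
    (hGφ : ∀ k ≤ n, G k * φ k = 1) (hne : ∃ i ≤ n, ∃ j ≤ n, G i ≠ G j) :
    ∃ t, a ≤ t ∧ t ≤ b ∧ (fwdDiff 1)^[t] φ 0 ≠ 0 := by
  by_contra! hzero
  set p := newtonPoly G (d + 1)
  set q := newtonPoly φ a
  have hp : ∀ k ≤ n, p.eval (k : F) = G k := fun k hk =>
    eval_newtonPoly G (fun j hj => factorial_cast_ne_zero hF (by omega)) (b := n)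
      (fun j hj => hG j (by omega)) hk
  have hq : ∀ k ≤ b, q.eval (k : F) = φ k := fun k hk =>
    eval_newtonPoly φ (fun j hj => factorial_cast_ne_zero hF (by omega)) hzero hk
  have hpd : p.natDegree ≤ d := natDegree_newtonPoly_le G (d + 1)
  have hqd : q.natDegree ≤ a - 1 := natDegree_newtonPoly_le φ a
  -- The degree is at most `d + (a - 1) < b + 1`, and `0, …, b` are `b + 1` distinct roots.
  have hpq : p * q - 1 = 0 := by
    refine Polynomial.eq_zero_of_natDegree_lt_card_of_eval_eq_zero (p * q - 1)
      (f := fun i : Fin (b + 1) => ((i : ℕ) : F)) ?_ ?_ ?_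
    · intro i j hij
      exact Fin.ext (natCast_inj_of_le hF (by omega) (by omega) hij)
    · intro i
      rw [Polynomial.eval_sub, Polynomial.eval_mul, hp _ (by omega), hq _ (by omega),
        hGφ _ (by omega), Polynomial.eval_one, sub_self]
    · rw [Fintype.card_fin]
      refine (Polynomial.natDegree_sub_le _ _).trans_lt ?_
      rw [Polynomial.natDegree_one, max_eq_left (Nat.zero_le _)]
      refine Polynomial.natDegree_mul_le.trans_lt ?_
      omega
  have hunit : IsUnit p := IsUnit.of_mul_eq_one q (sub_eq_zero.1 hpq)
  obtain ⟨c, -, hc⟩ := Polynomial.isUnit_iff.1 hunit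
  obtain ⟨i, hi, j, hj, hij⟩ := hne
  apply hij
  rw [← hp i hi, ← hp j hj, ← hc, Polynomial.eval_C, Polynomial.eval_C]

end Newton

/-! ### Rank of matrices depending on the intersection size -/

section IntersectionMatrix

variable {F : Type*} [Field F] {ι : Type*} [Fintype ι] [DecidableEq ι]

/-- The incidence matrix of the inclusion order on finite sets. -/
def zetaMatrix (F ι : Type*) [Field F] [DecidableEq ι] : Matrix (Finset ι) (Finset ι) F :=
  Matrix.of fun S T => if T ⊆ S then 1 else 0

/-- The matrix is unitriangular for inclusion, so a kernel vector vanishes by induction on the set.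
-/
theorem isUnit_zetaMatrix : IsUnit (zetaMatrix F ι) := by
  rw [← Matrix.mulVec_injective_iff_isUnit, ← Matrix.coe_mulVecLin, ← LinearMap.ker_eq_bot,
    LinearMap.ker_eq_bot']
  intro x hx
  funext S
  induction S using Finset.strongInduction with
  | H S ih =>
    have h := congrFun hx S
    simp only [Matrix.coe_mulVecLin, Matrix.mulVec, dotProduct, zetaMatrix, Matrix.of_apply] at h
    rw [Finset.sum_eq_single S] at h
    · simpa using h
    · intro T _ hTS
      by_cases hT : T ⊆ S
      · rw [ih T (hT.ssubset_of_ne hTS)]; simp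
      · simp [hT]
    · simp

/-- The matrix with entries `φ |S ∩ T|` has rank at least `binom n t` if the `t`-th finite
difference of `φ` at `0` does not vanish. -/
theorem choose_le_rank_card_inter (φ : ℕ → F) {t : ℕ} (ht : (fwdDiff 1)^[t] φ 0 ≠ 0) :
    (Fintype.card ι).choose t ≤
      (Matrix.of fun S T : Finset ι => φ (S ∩ T).card).rank := by
  classical
  set D : Matrix (Finset ι) (Finset ι) F :=
    Matrix.diagonal fun S : Finset ι => (fwdDiff 1)^[S.card] φ 0
  -- Newton's formula at `|S ∩ T|` is a sum of `Δ^|U| φ(0)` over the sets `U` contained in both `S`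
  -- and `T`.
  have hfac : (Matrix.of fun S T : Finset ι => φ (S ∩ T).card) =
      zetaMatrix F ι * (D * (zetaMatrix F ι).transpose) := by
    ext S T
    have h1 := shift_eq_sum_fwdDiff_iter 1 φ (S ∩ T).card 0
    simp only [smul_eq_mul, mul_one, zero_add] at h1
    rw [Matrix.of_apply, h1, ← Finset.sum_powerset_apply_card fun j => (fwdDiff 1)^[j] φ 0,
      Matrix.mul_apply]
    simp only [D, Matrix.diagonal_mul, Matrix.transpose_apply, zetaMatrix, Matrix.of_apply]
    simp only [mul_ite, mul_one, mul_zero, ite_mul, one_mul, zero_mul, ← ite_and]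
    rw [← Finset.sum_filter]
    refine Finset.sum_congr ?_ fun _ _ => rfl
    ext U
    simp only [Finset.mem_powerset, Finset.subset_inter_iff, Finset.mem_filter, Finset.mem_univ,
      true_and]
    tauto
  have hdet := (Matrix.isUnit_iff_isUnit_det _).1 (isUnit_zetaMatrix (F := F) (ι := ι))
  rw [hfac, Matrix.rank_mul_eq_right_of_isUnit_det _ _ hdet,
    Matrix.rank_mul_eq_left_of_isUnit_det _ _ (by rwa [Matrix.det_transpose]),
    Matrix.rank_diagonal, ← Finset.card_univ (α := ι), ← Finset.card_powersetCard,
    Fintype.card_subtype]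
  refine Finset.card_le_card fun S hS => ?_
  simpa [(Finset.mem_powersetCard.1 hS).2] using ht

end IntersectionMatrix

theorem two_pow_le_choose {n t : ℕ} (h : 2 * t ≤ n) : 2 ^ t ≤ n.choose t := by
  refine le_trans ?_ (Nat.choose_le_choose t h)
  change 2 ^ t ≤ t.centralBinom
  induction t with
  | zero => simp
  | succ t ih =>
    have h1 := Nat.succ_mul_centralBinom_succ t
    have h2 := ih (by omega)
    rw [pow_succ]
    have h3 : (t + 1) * (2 * t.centralBinom) ≤ (t + 1) * (t + 1).centralBinom := by
      rw [h1]; nlinarith [Nat.zero_le (t * t.centralBinom)]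
    have := Nat.le_of_mul_le_mul_left h3 t.succ_pos
    omega

/-! ### Polynomials affine in one variable -/

section AffineInOneVariable

variable {F : Type*} [Field F]

theorem MvPolynomial.exists_eval_update_eq_add_mul {σ : Type*} [Fintype σ] [DecidableEq σ]
    (p : MvPolynomial σ F) (j : σ) (hp : p.degreeOf j ≤ 1) (a : σ → F) :
    ∃ A B : F, ∀ t : F, MvPolynomial.eval (Function.update a j t) p = A + B * t := by
  rw [MvPolynomial.degreeOf_le_iff] at hp
  refine ⟨∑ m ∈ p.support, if m j = 0 then
      p.coeff m * ∏ i ∈ Finset.univ.erase j, a i ^ m i else 0,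
    ∑ m ∈ p.support, if m j = 0 then 0 else
      p.coeff m * ∏ i ∈ Finset.univ.erase j, a i ^ m i, fun t => ?_⟩
  rw [MvPolynomial.eval_eq', Finset.sum_mul, ← Finset.sum_add_distrib]
  refine Finset.sum_congr rfl fun m hm => ?_
  rw [← Finset.mul_prod_erase _ _ (Finset.mem_univ j), Function.update_self]
  have h1 : ∏ i ∈ Finset.univ.erase j, Function.update a j t i ^ m i =
      ∏ i ∈ Finset.univ.erase j, a i ^ m i :=
    Finset.prod_congr rfl fun i hi => by rw [Function.update_of_ne (Finset.ne_of_mem_erase hi)]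
  rw [h1]
  rcases Nat.le_one_iff_eq_zero_or_eq_one.1 (hp m hm) with h | h
  · simp [h]
  · simp [h]; ring

end AffineInOneVariable

/-! ### Width bounds the rank across a cut -/

namespace RoABP

variable {F τ : Type*} [Field F] [Fintype τ]

theorem layer_le_width (P : RoABP F τ) (i : Fin (Fintype.card τ + 1)) : P.layer i ≤ P.width :=
  Finset.le_sup (f := P.layer) (Finset.mem_univ i)

theorem one_le_width (P : RoABP F τ) : 1 ≤ P.width :=
  P.layer_source ▸ P.layer_le_width 0

theorem exists_poly_eq_C_of_degree_eq_zero (P : RoABP F τ) (hP : P.degree = 0) :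
    ∃ c : F, P.poly = MvPolynomial.C c := by
  have h0 : ∀ i u v, P.label i u v = Polynomial.C ((P.label i u v).coeff 0) := by
    intro i u v
    apply Polynomial.eq_C_of_natDegree_eq_zero
    rw [degree, ← Nat.bot_eq_zero, Finset.sup_eq_bot_iff] at hP
    have h1 := hP i (Finset.mem_univ i)
    rw [Finset.sup_eq_bot_iff] at h1
    exact h1 (u, v) (Finset.mem_univ _)
  refine ⟨∑ q : ((i : Fin (Fintype.card τ + 1)) → Fin (P.layer i)),
    ∏ i : Fin (Fintype.card τ), (P.label i (q i.castSucc) (q i.succ)).coeff 0, ?_⟩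
  rw [poly, map_sum]
  refine Finset.sum_congr rfl fun q _ => ?_
  rw [map_prod]
  refine Finset.prod_congr rfl fun i _ => ?_
  conv_lhs => rw [h0]
  rw [Polynomial.aeval_C, MvPolynomial.algebraMap_eq]

theorem eval_poly (P : RoABP F τ) (a : τ → F) :
    MvPolynomial.eval a P.poly =
      ∑ q : ((i : Fin (Fintype.card τ + 1)) → Fin (P.layer i)),
        ∏ i : Fin (Fintype.card τ),
          (P.label i (q i.castSucc) (q i.succ)).eval (a (P.order i)) := by
  rw [poly, map_sum]
  refine Finset.sum_congr rfl fun q _ => ?_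
  rw [map_prod]
  refine Finset.prod_congr rfl fun i _ => ?_
  rw [← MvPolynomial.coe_aeval_eq_eval, RingHom.coe_coe, ← Polynomial.aeval_algHom_apply,
    MvPolynomial.aeval_X, Polynomial.coe_aeval_eq_eval]

theorem prod_eq_prod_lt_mul_prod_gt {N : ℕ} (g : Fin N → F) (k : Fin N) :
    ∏ i, g i = (∏ i, if i < k then g i else 1) * (g k * ∏ i, if k < i then g i else 1) := by
  have h : g k = ∏ i, if i = k then g i else 1 := by simp
  conv_rhs => rw [h]
  rw [← Finset.prod_mul_distrib, ← Finset.prod_mul_distrib]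
  refine Finset.prod_congr rfl fun i _ => ?_
  rcases lt_trichotomy i k with h | h | h
  · simp [h, h.ne, h.not_gt]
  · simp [h]
  · simp [h, h.ne', h.not_gt]

/-- Cutting a roABP at the layer in which the `k`-th variable is read. -/
theorem exists_eval_eq_sum_mul (P : RoABP F τ) (k : Fin (Fintype.card τ)) :
    ∃ L R : (τ → F) → Fin (P.layer k.castSucc) → F,
      (∀ a, MvPolynomial.eval a P.poly = ∑ s, L a s * R a s) ∧
      (∀ a a', (∀ i < k, a (P.order i) = a' (P.order i)) → L a = L a') ∧
      (∀ a a', (∀ i, k ≤ i → a (P.order i) = a' (P.order i)) → R a = R a') := by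
  -- A path splits at its vertex `s` in the cut layer: `A` collects the labels before layer `k`, and
  -- `B` those after it. The label of layer `k` itself goes to the right factor `R`.
  let e (a : τ → F) (i : Fin (Fintype.card τ)) (u : Fin (P.layer i.castSucc))
    (v : Fin (P.layer i.succ)) : F := (P.label i u v).eval (a (P.order i))
  let A (a : τ → F) (q : (j : {j // j ≤ k.castSucc}) → Fin (P.layer j)) : F :=
    ∏ i : Fin (Fintype.card τ), if h : i < k then
      e a i (q ⟨i.castSucc, Fin.castSucc_le_castSucc_iff.2 h.le⟩)
        (q ⟨i.succ, Fin.succ_le_castSucc_iff.2 h⟩) else 1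
  let B (a : τ → F) (q : (j : {j // ¬ j ≤ k.castSucc}) → Fin (P.layer j)) : F :=
    ∏ i : Fin (Fintype.card τ), if h : k < i then
      e a i (q ⟨i.castSucc, not_le.2 (Fin.castSucc_lt_castSucc_iff.2 h)⟩)
        (q ⟨i.succ, not_le.2 (Fin.castSucc_lt_succ_iff.2 h.le)⟩) else 1
  let R (a : τ → F) (s : Fin (P.layer k.castSucc)) : F :=
    ∑ q : ((j : {j // ¬ j ≤ k.castSucc}) → Fin (P.layer j)),
      e a k s (q ⟨k.succ, not_le.2 Fin.castSucc_lt_succ⟩) * B a q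
  let L (a : τ → F) (s : Fin (P.layer k.castSucc)) : F :=
    ∑ q : ((j : {j // j ≤ k.castSucc}) → Fin (P.layer j)),
      if q ⟨k.castSucc, le_rfl⟩ = s then A a q else 0
  refine ⟨L, R, fun a => ?_, fun a a' h => ?_, fun a a' h => ?_⟩
  · have h1 : ∑ s, L a s * R a s =
        ∑ q : ((j : {j // j ≤ k.castSucc}) → Fin (P.layer j)),
          A a q * R a (q ⟨k.castSucc, le_rfl⟩) := by
      simp only [L, Finset.sum_mul, ite_mul, zero_mul]
      rw [Finset.sum_comm]
      simp
    rw [h1, eval_poly]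
    simp only [R, Finset.mul_sum]
    rw [← Fintype.sum_prod_type']
    refine Fintype.sum_equiv
      (Equiv.piEquivPiSubtypeProd (fun j => j ≤ k.castSucc) fun j => Fin (P.layer j)) _ _
      fun q => ?_
    rw [prod_eq_prod_lt_mul_prod_gt _ k]
    simp only [A, B, e, Equiv.piEquivPiSubtypeProd_apply, dite_eq_ite]
  · funext s
    refine Finset.sum_congr rfl fun q _ => ?_
    have hA : A a q = A a' q := by
      refine Finset.prod_congr rfl fun i _ => ?_
      split_ifs with hi
      · simp only [e, h i hi]
      · rfl
    rw [hA]
  · funext s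
    refine Finset.sum_congr rfl fun q _ => ?_
    have hBq : B a q = B a' q := by
      refine Finset.prod_congr rfl fun i _ => ?_
      split_ifs with hi
      · simp only [e, h i hi.le]
      · rfl
    rw [hBq]
    simp only [e, h k le_rfl]

/-- If the assignment `a S T` depends on `S` only in the variables read before the `k`-th one and
on `T` only in the others, then the matrix of the values of the roABP has rank at most its width. -/
theorem rank_eval_le_width (P : RoABP F τ) (k : Fin (Fintype.card τ)) {κ : Type*} [Fintype κ]
    [Nonempty κ] (a : κ → κ → τ → F)
    (hl : ∀ i < k, ∀ S T T', a S T (P.order i) = a S T' (P.order i))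
    (hr : ∀ i, k ≤ i → ∀ S S' T, a S T (P.order i) = a S' T (P.order i)) :
    (Matrix.of fun S T => MvPolynomial.eval (a S T) P.poly).rank ≤ P.width := by
  obtain ⟨L, R, hLR, hL, hR⟩ := P.exists_eval_eq_sum_mul k
  obtain ⟨o⟩ := ‹Nonempty κ›
  have hfac : (Matrix.of fun S T => MvPolynomial.eval (a S T) P.poly) =
      (Matrix.of fun S s => L (a S o) s) * (Matrix.of fun s T => R (a o T) s) := by
    ext S T
    rw [Matrix.of_apply, hLR, Matrix.mul_apply]
    refine Finset.sum_congr rfl fun s _ => ?_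
    rw [hL (a S T) (a S o) fun i hi => hl i hi S T o, hR (a S T) (a o T) fun i hi => hr i hi S o T]
    rfl
  rw [hfac]
  refine (Matrix.rank_mul_le_left _ _).trans ?_
  refine (Matrix.rank_le_card_width _).trans ?_
  rw [Fintype.card_fin]
  exact P.layer_le_width _

end RoABP

/-! ### From refutations to inverses on the cube -/

section Refutation

variable {F : Type*} [Field F]

theorem IsIPSLinPrimeRefutation.eval_mul_eval_eq_one {σ : Type*} [Fintype σ]
    {f : MvPolynomial σ F} {C : MvPolynomial (IPSVar σ Unit) F}
    (hC : IsIPSLinPrimeRefutation (fun _ : Unit => f) C) (v : σ → F)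
    (hv : ∀ i, v i = 0 ∨ v i = 1) :
    MvPolynomial.eval (Sum.elim v (Sum.elim (fun _ => 1) fun _ => 0)) C *
      MvPolynomial.eval v f = 1 := by
  classical
  obtain ⟨h0, h1, hdeg⟩ := hC
  obtain ⟨A, B, hAB⟩ := C.exists_eval_update_eq_add_mul (Sum.inr (Sum.inl ())) (hdeg ())
    (Sum.elim v fun _ => 0)
  have hupd : ∀ t : F, Function.update (Sum.elim v fun _ : Unit ⊕ σ => (0 : F))
      (Sum.inr (Sum.inl ())) t = Sum.elim v (Sum.elim (fun _ => t) fun _ => 0) := by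
    intro t
    funext i
    rcases i with i | ⟨⟨⟩⟩ | i <;> simp [Function.update]
  have e0 : A + B * 0 = 0 := by
    have h0' := congrArg (MvPolynomial.eval v) h0
    rw [eval_aeval_eq_eval, map_zero] at h0'
    rw [← hAB, hupd]
    refine Eq.trans ?_ h0'
    congr 2
    funext i
    rcases i with i | ⟨⟨⟩⟩ | i <;> simp
  have e1 : A + B * MvPolynomial.eval v f = 1 := by
    have h1' := congrArg (MvPolynomial.eval v) h1
    rw [eval_aeval_eq_eval, map_one] at h1'
    rw [← hAB, hupd]
    refine Eq.trans ?_ h1'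
    congr 2
    funext i
    rcases i with i | ⟨⟨⟩⟩ | i
    · simp
    · simp
    · rcases hv i with h | h <;> simp [h]
  rw [← hupd, hAB]
  linear_combination e1 - e0 + e0 * MvPolynomial.eval v f

/-- A constant cannot be both `0` and `1` under the two substitutions. This matters because the
degree is a factor of the size. -/
theorem IsIPSLinPrimeRefutation.degree_pos {σ ι : Type*} [Fintype σ] [Fintype ι]
    {f : ι → MvPolynomial σ F} {P : RoABP F (IPSVar σ ι)}
    (hP : IsIPSLinPrimeRefutation f P.poly) : 0 < P.degree := by
  rw [Nat.pos_iff_ne_zero]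
  intro h
  obtain ⟨c, hc⟩ := P.exists_poly_eq_C_of_degree_eq_zero h
  obtain ⟨h0, h1, -⟩ := hP
  rw [hc, MvPolynomial.aeval_C] at h0 h1
  exact zero_ne_one (h0.symm.trans h1)

end Refutation

/-! ### Matching the two halves of the variable order -/

section Matching

variable {n : ℕ}

/-- The `i`-th element of the first half of the order `π`. -/
def firstHalf (π : Equiv.Perm (Fin (2 * n))) (i : Fin n) : Fin (2 * n) := π ⟨i, by omega⟩

/-- The `i`-th element of the second half of the order `π`. -/
def secondHalf (π : Equiv.Perm (Fin (2 * n))) (i : Fin n) : Fin (2 * n) := π ⟨n + i, by omega⟩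

theorem firstHalf_ne_secondHalf (π : Equiv.Perm (Fin (2 * n))) (i j : Fin n) :
    firstHalf π i ≠ secondHalf π j := by
  intro h
  have := Fin.mk.inj (π.injective h)
  omega

/-- The pair of the `i`-th elements of the two halves of `π`. -/
def matchingPair (π : Equiv.Perm (Fin (2 * n))) (i : Fin n) : Pairs n :=
  ⟨(min (firstHalf π i) (secondHalf π i), max (firstHalf π i) (secondHalf π i)), by
    simpa using (firstHalf_ne_secondHalf π i i).symm⟩

theorem matchingPair_injective (π : Equiv.Perm (Fin (2 * n))) :
    Function.Injective (matchingPair π) := by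
  intro i j h
  have h1 : min (firstHalf π i) (secondHalf π i) = min (firstHalf π j) (secondHalf π j) :=
    congrArg (fun p : Pairs n => p.1.1) h
  have h2 : max (firstHalf π i) (secondHalf π i) = max (firstHalf π j) (secondHalf π j) :=
    congrArg (fun p : Pairs n => p.1.2) h
  have h3 : firstHalf π i = firstHalf π j := by
    have hij := firstHalf_ne_secondHalf π i j
    have hji := firstHalf_ne_secondHalf π j i
    grind
  exact Fin.ext (Fin.mk.inj (π.injective h3))

variable (F : Type*) [Field F]

/-- The variables `x` take the values of `S` on the first half of `π` and those of `T` on the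
second, and `z` is the indicator of the matching of the two halves. -/
noncomputable def matchingAssignment (π : Equiv.Perm (Fin (2 * n))) (S T : Finset (Fin n)) :
    LiftVar n → F :=
  Sum.elim
    (fun j => if h : (π.symm j : ℕ) < n then boolVec F S ⟨π.symm j, h⟩
      else boolVec F T ⟨π.symm j - n, by omega⟩)
    (boolVec F (Finset.univ.image (matchingPair π)))

theorem matchingAssignment_firstHalf (π : Equiv.Perm (Fin (2 * n))) (S T : Finset (Fin n))
    (i : Fin n) : matchingAssignment F π S T (Sum.inl (firstHalf π i)) = boolVec F S i := by
  simp [matchingAssignment, firstHalf]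

theorem matchingAssignment_secondHalf (π : Equiv.Perm (Fin (2 * n))) (S T : Finset (Fin n))
    (i : Fin n) : matchingAssignment F π S T (Sum.inl (secondHalf π i)) = boolVec F T i := by
  simp [matchingAssignment, secondHalf]

theorem matchingAssignment_boolean (π : Equiv.Perm (Fin (2 * n))) (S T : Finset (Fin n))
    (v : LiftVar n) :
    matchingAssignment F π S T v = 0 ∨ matchingAssignment F π S T v = 1 := by
  rcases v with j | p
  · simp only [matchingAssignment, Sum.elim_inl, boolVec]
    split_ifs <;> simp
  · simp only [matchingAssignment, Sum.elim_inr, boolVec]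
    split_ifs <;> simp

/-- Off the matching `z` kills the gadget; on the `i`-th matching edge the two `x` values multiply
to the indicator of `i ∈ S ∩ T`. -/
theorem eval_gadget_matchingAssignment (π : Equiv.Perm (Fin (2 * n))) (S T : Finset (Fin n))
    (p : Pairs n) :
    MvPolynomial.eval (matchingAssignment F π S T) (gadget F n p) =
      boolVec F ((S ∩ T).image (matchingPair π)) p := by
  simp only [gadget, map_mul, MvPolynomial.eval_X]
  by_cases hp : p ∈ Finset.univ.image (matchingPair π)
  · obtain ⟨i, -, rfl⟩ := Finset.mem_image.1 hp
    have h1 : matchingAssignment F π S T (Sum.inr (matchingPair π i)) = 1 := by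
      simp [matchingAssignment, boolVec]
    have h2 : matchingAssignment F π S T (Sum.inl (matchingPair π i).1.1) *
        matchingAssignment F π S T (Sum.inl (matchingPair π i).1.2) =
        boolVec F S i * boolVec F T i := by
      rw [← matchingAssignment_firstHalf F π S T i, ← matchingAssignment_secondHalf F π S T i]
      rcases le_total (firstHalf π i) (secondHalf π i) with h | h
      · simp [matchingPair, h]
      · simp [matchingPair, h, mul_comm]
    rw [h1, one_mul, h2]
    simp only [boolVec, (matchingPair_injective π).mem_finset_image, Finset.mem_inter]
    by_cases hS : i ∈ S <;> simp [hS]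
  · have h1 : matchingAssignment F π S T (Sum.inr p) = 0 := by
      simp only [matchingAssignment, Sum.elim_inr, boolVec, if_neg hp]
    have h2 : p ∉ (S ∩ T).image (matchingPair π) := fun h =>
      hp (Finset.image_subset_image (Finset.subset_univ _) h)
    rw [h1, boolVec, if_neg h2, zero_mul, zero_mul]

theorem eval_liftSymm_matchingAssignment (h : MvPolynomial (Fin n) F)
    (π : Equiv.Perm (Fin (2 * n))) (S T : Finset (Fin n)) :
    MvPolynomial.eval (matchingAssignment F π S T) (liftSymm h) =
      weightValue h (S ∩ T).card := by
  rw [eval_liftSymm h _ _ (eval_gadget_matchingAssignment F π S T),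
    Finset.card_image_of_injective _ (matchingPair_injective π)]

variable {F}

/-- In any variable order, the width of a roABP refutation of the lifted instance is at least the
rank of the matrix of the inverses of `f - β` at the intersections of two sets. -/
theorem rank_inv_weightValue_le_width (hn : 1 ≤ n) (h : MvPolynomial (Fin n) F) (β : F)
    (P : RoABP F (IPSVar (LiftVar n) Unit))
    (hP : IsIPSLinPrimeRefutation (fun _ : Unit => liftSymm h - MvPolynomial.C β) P.poly) :
    (Matrix.of fun S T : Finset (Fin n) => (weightValue h (S ∩ T).card - β)⁻¹).rank
      ≤ P.width := by
  let pos : Fin (2 * n) → Fin (Fintype.card (IPSVar (LiftVar n) Unit)) :=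
    fun j => P.order.symm (Sum.inl (Sum.inl j))
  have hpos : Function.Injective pos := fun i j hij =>
    Sum.inl_injective (Sum.inl_injective (P.order.symm.injective hij))
  -- `π` lists the `x` variables in reading order; the cut is at the `(n+1)`-st of them. The `z`,
  -- `y` and `u` values do not depend on `S` or `T`, so their positions are irrelevant.
  set π := Tuple.sort pos
  have hmono : Monotone (pos ∘ π) := Tuple.monotone_sort pos
  let mid : Fin (2 * n) := ⟨n, by omega⟩
  have hval : ∀ S T : Finset (Fin n), (weightValue h (S ∩ T).card - β)⁻¹ =
      MvPolynomial.eval (Sum.elim (matchingAssignment F π S T)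
        (Sum.elim (fun _ => 1) fun _ => 0)) P.poly := by
    intro S T
    have h1 := hP.eval_mul_eval_eq_one (matchingAssignment F π S T)
      (matchingAssignment_boolean F π S T)
    rw [map_sub, MvPolynomial.eval_C, eval_liftSymm_matchingAssignment] at h1
    exact (eq_inv_of_mul_eq_one_left h1).symm
  simp only [hval]
  refine P.rank_eval_le_width (pos (π mid)) _ ?_ ?_
  · intro i hi S T T'
    obtain ⟨v, rfl⟩ := P.order.symm.surjective i
    rw [Equiv.apply_symm_apply]
    rcases v with (j | p) | v
    · have hj : (π.symm j : ℕ) < n := by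
        by_contra! hj
        have h1 : pos (π mid) ≤ pos (π (π.symm j)) := hmono (show mid ≤ π.symm j from hj)
        rw [Equiv.apply_symm_apply] at h1
        exact absurd hi (not_lt.2 h1)
      simp [matchingAssignment, hj]
    · rfl
    · rfl
  · intro i hi S S' T
    obtain ⟨v, rfl⟩ := P.order.symm.surjective i
    rw [Equiv.apply_symm_apply]
    rcases v with (j | p) | v
    · have hj : ¬ (π.symm j : ℕ) < n := by
        intro hj
        have h1 : pos (π (π.symm j)) ≤ pos (π mid) := hmono (show π.symm j ≤ mid from hj.le)
        rw [Equiv.apply_symm_apply] at h1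
        have h2 : j = π mid := hpos (le_antisymm h1 hi)
        rw [h2, Equiv.symm_apply_apply] at hj
        exact lt_irrefl n hj
      simp [matchingAssignment, hj]
    · rfl
    · rfl

end Matching

/-! ### Choice of parameters and conclusion -/

theorem natCast_ne_zero_of_lt_ringChar {F : Type*} [Field F] {N k : ℕ}
    (hF : ringChar F = 0 ∨ N < ringChar F) (hk : 0 < k) (hkN : k ≤ N) : (k : F) ≠ 0 := by
  intro h
  have hdvd := (ringChar.spec F k).1 h
  rcases hF with h0 | h0
  · rw [h0, zero_dvd_iff] at hdvd
    omega
  · have := Nat.le_of_dvd hk hdvd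
    omega

theorem two_pow_quarter_le_width {F : Type*} [Field F] {n : ℕ} (hn : 4 ≤ n)
    (h : MvPolynomial (Fin n) F) (β : F)
    (hF : ∀ k : ℕ, 0 < k → k ≤ n → (k : F) ≠ 0)
    (hdeg : 8 * (substEsymm h).totalDegree ≤ n)
    (hne : NonconstantOnCube (substEsymm h))
    (hβ : BooleanUnsat (substEsymm h - MvPolynomial.C β))
    (P : RoABP F (IPSVar (LiftVar n) Unit))
    (hP : IsIPSLinPrimeRefutation (fun _ : Unit => liftSymm h - MvPolynomial.C β) P.poly) :
    2 ^ (n / 4) ≤ P.width := by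
  have hunsat : ∀ k ≤ n, weightValue h k - β ≠ 0 := by
    intro k hk
    obtain ⟨S, -, rfl⟩ := Finset.exists_subset_card_eq (s := (Finset.univ : Finset (Fin n)))
      (n := k) (by simpa using hk)
    have h1 := hβ (boolVec F S) fun i => by simp only [boolVec]; split_ifs <;> simp
    rwa [map_sub, MvPolynomial.eval_C, eval_substEsymm_boolVec] at h1
  -- For `n ≥ 4` and `d ≤ n / 8`, the interval `[n/4, n/2]` has length at least `d`. Its lower end
  -- gives `2 ^ (n / 4)`, and its upper end ensures `2 * t ≤ n`.
  obtain ⟨t, hat, htb, ht⟩ := exists_fwdDiff_iter_ne_zero (F := F) (n := n) (a := n / 4)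
    (b := n / 2) (d := (substEsymm h).totalDegree) hF (by omega) (by omega) (by omega)
    (fun k => weightValue h k - β) (fun k => (weightValue h k - β)⁻¹)
    (fun j hj hjn => by
      have h1 : (fun k => weightValue h k - β) = weightValue h + fun _ => -β := by
        funext k; simp [sub_eq_add_neg]
      rw [h1, fwdDiff_iter_add, Pi.add_apply, fwdDiff_iter_weightValue_eq_zero h hj hjn, zero_add]
      obtain ⟨i, rfl⟩ := Nat.exists_eq_succ_of_ne_zero (show j ≠ 0 by omega)
      rw [Function.iterate_succ_apply, fwdDiff_const]
      exact congrFun (Function.iterate_fixed (by funext; simp [fwdDiff]) i) 0)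
    (fun k hk => mul_inv_cancel₀ (hunsat k hk))
    (by
      obtain ⟨a, b, ha, hb, hab⟩ := hne
      obtain ⟨S, rfl⟩ := exists_eq_boolVec a ha
      obtain ⟨T, rfl⟩ := exists_eq_boolVec b hb
      rw [eval_substEsymm_boolVec, eval_substEsymm_boolVec] at hab
      exact ⟨S.card, by simpa using S.card_le_univ, T.card, by simpa using T.card_le_univ,
        fun hST => hab (sub_left_injective hST)⟩)
  have h1 := choose_le_rank_card_inter (ι := Fin n) _ ht
  rw [Fintype.card_fin] at h1
  calc 2 ^ (n / 4) ≤ 2 ^ t := Nat.pow_le_pow_right (by norm_num) hat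
    _ ≤ n.choose t := two_pow_le_choose (by omega)
    _ ≤ _ := h1
    _ ≤ P.width := rank_inv_weightValue_le_width (by omega) h β P hP

theorem exists_forall_mul_log_le (K : ℝ) :
    ∃ N : ℕ, ∀ n : ℕ, N ≤ n → K * Real.log n ≤ n / 8 := by
  have h1 := (Real.isLittleO_log_id_atTop.const_mul_left K).bound (c := 1 / 8) (by norm_num)
  obtain ⟨N, hN⟩ := Filter.eventually_atTop.1 (tendsto_natCast_atTop_atTop.eventually h1)
  refine ⟨N, fun n hn => (le_abs_self _).trans ?_⟩
  have h2 := hN n hn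
  simp only [Real.norm_eq_abs, id, Nat.abs_cast] at h2
  linarith

theorem mainTheorem5 (K : ℝ) :
    ∃ c : ℝ, 0 < c ∧
      ∀ (n : ℕ), 1 ≤ n →
      ∀ (F : Type*) [Field F] (f h : MvPolynomial (Fin n) F) (β : F),
        f.IsSymmetric →
        f = substEsymm h →
        (f.totalDegree : ℝ) ≤ K * Real.log n →
        (ringChar F = 0 ∨
          max (2 ^ (4 * n + 2 * n.choose 2)) (n ^ f.totalDegree) < ringChar F) →
        NonconstantOnCube f →
        BooleanUnsat (f - MvPolynomial.C β) →
        BooleanUnsat (liftSymm h - MvPolynomial.C β) →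
        ∀ P : RoABP F (IPSVar (LiftVar n) Unit),
          IsIPSLinPrimeRefutation (fun _ : Unit => liftSymm h - MvPolynomial.C β) P.poly →
          (2 : ℝ) ^ (c * n) ≤ (P.size : ℝ) := by
  obtain ⟨N, hN⟩ := exists_forall_mul_log_le K
  -- The bound `1 / (N + 4)` makes `c * n ≤ 1` for small `n`, where size at least `2` suffices; `1 /
  -- 8` absorbs the floor, since `n ≤ 8 * (n / 4)` once `n ≥ 4`.
  refine ⟨min (1 / 8) (1 / (N + 4)), by positivity, ?_⟩
  intro n hn F _ f h β _ hfh hdeg hchar hne hβ _ P hP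
  subst hfh
  have hcard : 2 ≤ Fintype.card (IPSVar (LiftVar n) Unit) := by
    simp only [Fintype.card_sum, Fintype.card_fin, Fintype.card_unit]
    omega
  have hpos := hP.degree_pos
  have hwidth := P.one_le_width
  have hsize : 4 * P.width ≤ P.size := by
    calc 4 * P.width = 2 * P.width * 1 * 2 := by ring
      _ ≤ P.size := Nat.mul_le_mul (Nat.mul_le_mul (Nat.mul_le_mul_right _ hcard) hpos) hcard
  have hn0 : (0 : ℝ) < n := by exact_mod_cast hn
  rcases lt_or_ge n (N + 4) with hlt | hge
  · have h1 : min (1 / 8) (1 / ((N : ℝ) + 4)) * n ≤ 1 := by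
      refine (mul_le_mul_of_nonneg_right (min_le_right _ _) hn0.le).trans ?_
      rw [one_div_mul_eq_div, div_le_one (by positivity)]
      exact_mod_cast hlt.le
    calc (2 : ℝ) ^ (min (1 / 8) (1 / ((N : ℝ) + 4)) * n) ≤ 2 ^ (1 : ℝ) :=
          Real.rpow_le_rpow_of_exponent_le (by norm_num) h1
      _ = 2 := Real.rpow_one 2
      _ ≤ P.size := by exact_mod_cast (by omega : 2 ≤ P.size)
  · have hdeg8 : 8 * (substEsymm h).totalDegree ≤ n := by
      have h1 := hdeg.trans (hN n (by omega))
      have h2 : 8 * ((substEsymm h).totalDegree : ℝ) ≤ n := by linarith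
      exact_mod_cast h2
    -- The argument needs only `1, …, n` to be invertible, and `n < 2 ^ n`.
    have hF : ∀ k : ℕ, 0 < k → k ≤ n → (k : F) ≠ 0 := by
      intro k hk hkn
      refine natCast_ne_zero_of_lt_ringChar (hchar.imp_right fun h1 =>
        (le_max_left _ _).trans_lt h1) hk (hkn.trans ?_)
      exact (Nat.lt_two_pow_self (n := n)).le.trans (Nat.pow_le_pow_right (by norm_num) (by omega))
    have hw := two_pow_quarter_le_width (by omega) h β hF hdeg8 hne hβ P hP
    have h1 : min (1 / 8) (1 / ((N : ℝ) + 4)) * n ≤ ((n / 4 : ℕ) : ℝ) := by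
      refine (mul_le_mul_of_nonneg_right (min_le_left _ _) hn0.le).trans ?_
      have h2 : (n : ℝ) ≤ 8 * ((n / 4 : ℕ) : ℝ) := by
        exact_mod_cast (by omega : n ≤ 8 * (n / 4))
      linarith
    calc (2 : ℝ) ^ (min (1 / 8) (1 / ((N : ℝ) + 4)) * n) ≤ 2 ^ ((n / 4 : ℕ) : ℝ) :=
          Real.rpow_le_rpow_of_exponent_le (by norm_num) h1
      _ = ((2 ^ (n / 4) : ℕ) : ℝ) := by rw [Real.rpow_natCast]; norm_cast
      _ ≤ P.size := by exact_mod_cast (by omega : 2 ^ (n / 4) ≤ P.size)
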